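/- Call a real $n\times n$ matrix a correlation matrix if it is symmetric and positive semidefinite and all its diagonal entries equal $1$, and let $\mathcal{C}_n$ be the set of non-singular $n\times n$ correlation matrices. For $A\in\mathbb{R}^{n\times n}$ and $x\in\mathbb{R}^n$ let $A[x]$ be the matrix $A$ with its diagonal replaced by $x$, let $e^{A}=\sum_{k\ge 0}A^k/k!$, and let $\mathrm{vecl}(A)\in\mathbb{R}^{n(n-1)/2}$ be the vector of the entries of $A$ strictly below the diagonal, stacked column by column. For a symmetric positive definite matrix $C=Q\,\mathrm{diag}(\lambda_1,\dots,\lambda_n)\,Q'$ with $Q$ orthogonal, let $\log C=Q\,\mathrm{diag}(\log\lambda_1,\dots,\log\lambda_n)\,Q'$. Then: (1) for every real symmetric matrix $A\in\mathbb{R}^{n\times n}$ there exists a unique vector $x^{\ast}\in\mathbb{R}^{n}$ such that $e^{A[x^{\ast}]}$ is a correlation matrix; (2) the map $\gamma(C)=\mathrm{vecl}(\log C)$ is a bijection from $\mathcal{C}_n$ onto $\mathbb{R}^{n(n-1)/2}$. -/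

import Mathlib

/-- A (possibly singular) `n × n` correlation matrix: a real matrix that is symmetric positive
semidefinite (`Matrix.PosSemidef` includes symmetry) and has ones on its diagonal. -/
def IsCorrelationMatrix {n : ℕ} (C : Matrix (Fin n) (Fin n) ℝ) : Prop :=
  C.PosSemidef ∧ ∀ i, C i i = 1

/-- The set of non-singular `n × n` correlation matrices. -/
def nonsingularCorrelationMatrices (n : ℕ) : Set (Matrix (Fin n) (Fin n) ℝ) :=
  {C | IsCorrelationMatrix C ∧ IsUnit C}

/-- `A[x]`: the matrix `A` with its diagonal replaced by the vector `x`. -/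
def replaceDiag {n : ℕ} (A : Matrix (Fin n) (Fin n) ℝ) (x : Fin n → ℝ) :
    Matrix (Fin n) (Fin n) ℝ :=
  Matrix.of fun i j => if i = j then x i else A i j

/-- The positions strictly below the diagonal, written as pairs (column, row) and ordered
lexicographically, that is, column after column. -/
def belowDiag (n : ℕ) : Finset (Fin n ×ₗ Fin n) :=
  Finset.univ.filter fun p => (ofLex p).1 < (ofLex p).2

theorem card_belowDiag (n : ℕ) : (belowDiag n).card = n * (n - 1) / 2 := by
  have h1 : (belowDiag n).card
      = ((Finset.univ : Finset (Fin n × Fin n)).filter fun p => p.1 < p.2).card := by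
    refine Finset.card_bij (fun p _ => ofLex p) ?_ ?_ ?_
    · intro p hp
      simpa [belowDiag] using hp
    · intro p _ q _ h
      exact h
    · intro q hq
      exact ⟨toLex q, by simpa [belowDiag] using hq, rfl⟩
  rw [h1, Finset.card_filter, Fintype.sum_prod_type_right]
  have h2 : ∀ j : Fin n, (∑ i : Fin n, if i < j then 1 else 0) = (j : ℕ) := by
    intro j
    rw [← Finset.card_filter, Finset.filter_gt_eq_Iio]
    exact Fin.card_Iio j
  simp only [h2]
  rw [Fin.sum_univ_eq_sum_range (fun i => i) n, Finset.sum_range_id]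

/-- `vecl A`: the elements of `A` below the diagonal, stacked column by column. -/
def vecl {n : ℕ} (A : Matrix (Fin n) (Fin n) ℝ) : Fin (n * (n - 1) / 2) → ℝ :=
  fun k =>
    let p := ofLex ((belowDiag n).orderEmbOfFin (card_belowDiag n) k)
    A p.2 p.1

/-- The logarithm of a symmetric positive definite matrix: if `A = Q diag(λ) Qᵀ` with `Q`
orthogonal, then `matrixLog A = Q diag(log λ) Qᵀ` (see `Matrix.IsHermitian.cfc_eq`). -/
noncomputable def matrixLog {n : ℕ} (A : Matrix (Fin n) (Fin n) ℝ) : Matrix (Fin n) (Fin n) ℝ :=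
  cfc Real.log A

/-- `γ(C) = vecl (log C)` for a non-singular correlation matrix `C`. -/
noncomputable def corrGamma (n : ℕ) (C : nonsingularCorrelationMatrices n) :
    Fin (n * (n - 1) / 2) → ℝ :=
  vecl (matrixLog C.1)

/-! Both parts rest on one inequality for real symmetric matrices, Klein's inequality
`tr e^X - tr e^Y ≥ tr ((X - Y) e^Y)`, with equality only for `X = Y`. In eigenbases of `X` and `Y`
every trace `tr (f(X) g(Y))` is `∑ i j, f(λᵢ) g(μⱼ) Wᵢⱼ²`, where `W` is the orthogonal matrix
changing one basis into the other (`trace_cfc_mul_cfc`), so the inequality reduces to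
`e^a - e^b ≥ (a - b) e^b` for real numbers.

For `A` symmetric put `f(x) = tr e^{A[x]} - ∑ xᵢ`. Klein's inequality says that
`diag e^{A[y]} - 1` is a subgradient of `f` at `y`.

* Uniqueness: if this subgradient vanishes at `x` and at `y`, Klein's inequality for the two orders
  of `(A[x], A[y])` has right-hand sides of opposite sign, so equality holds and `A[x] = A[y]`.
* Existence: Klein's inequality with `Y = diag x` gives `f(x) ≥ ∑ (e^{xᵢ} - xᵢ)`, so `f` is coercive
  and has a minimizer. Comparing the minimizer with nearby points, along the subgradient at the
  minimizer, shows by continuity that this subgradient is zero; no derivative of the matrix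
  exponential is needed.

The second part follows because `exp` and `log` are mutually inverse between symmetric and positive
definite matrices, and a symmetric matrix is determined up to its diagonal by its `vecl`, which can
be prescribed freely. -/

/-! ### Klein's inequality -/

open Matrix in
/-- The trace of `f(X) g(Y)` in terms of the eigenvalues of `X` and `Y` and the orthogonal matrix
between their eigenbases. -/
theorem trace_cfc_mul_cfc {n : Type*} [Fintype n] [DecidableEq n] {X Y : Matrix n n ℝ}
    (hX : X.IsHermitian) (hY : Y.IsHermitian) (f g : ℝ → ℝ) :
    (cfc f X * cfc g Y).trace = ∑ i, ∑ j, f (hX.eigenvalues i) * g (hY.eigenvalues j) *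
      ((star (hX.eigenvectorUnitary : Matrix n n ℝ) *
        (hY.eigenvectorUnitary : Matrix n n ℝ)) i j) ^ 2 := by
  rw [hX.cfc_eq, hY.cfc_eq, IsHermitian.cfc, IsHermitian.cfc, Unitary.conjStarAlgAut_apply,
    Unitary.conjStarAlgAut_apply]
  set U : Matrix n n ℝ := (hX.eigenvectorUnitary : Matrix n n ℝ)
  set V : Matrix n n ℝ := (hY.eigenvectorUnitary : Matrix n n ℝ)
  set W := star U * V with hW
  have hW' : star V * U = Wᵀ := by
    rw [hW, transpose_mul]
    simp [star_eq_conjTranspose, conjTranspose_eq_transpose_of_trivial]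
  set D := diagonal ((RCLike.ofReal : ℝ → ℝ) ∘ f ∘ hX.eigenvalues) with hD
  set E := diagonal ((RCLike.ofReal : ℝ → ℝ) ∘ g ∘ hY.eigenvalues) with hE
  have h1 : (U * D * star U * (V * E * star V)).trace = (D * W * (E * Wᵀ)).trace := by
    rw [← hW', hW]
    simp only [mul_assoc]
    rw [trace_mul_comm]
    simp only [mul_assoc]
  have h2 : (U * D * star U * (V * E * star V)).trace = ∑ i, ∑ j, (D * W) i j * (E * Wᵀ) j i := by
    rw [h1]; rfl
  refine h2.trans (Finset.sum_congr rfl fun i _ => Finset.sum_congr rfl fun j _ => ?_)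
  rw [hD, hE, diagonal_mul, diagonal_mul]
  simp
  ring

open scoped Matrix.Norms.L2Operator in
theorem exp_eq_cfc_real_exp {n : ℕ} {X : Matrix (Fin n) (Fin n) ℝ} (hX : X.IsHermitian) :
    NormedSpace.exp X = cfc Real.exp X :=
  (CFC.real_exp_eq_normedSpace_exp (a := X) hX).symm

open scoped Matrix.Norms.L2Operator in
theorem continuous_matrix_exp (n : ℕ) :
    Continuous (NormedSpace.exp : Matrix (Fin n) (Fin n) ℝ → Matrix (Fin n) (Fin n) ℝ) :=
  let _ : NormedAlgebra ℚ (Matrix (Fin n) (Fin n) ℝ) := NormedAlgebra.restrictScalars ℚ ℝ _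
  NormedSpace.exp_continuous

theorem exp_sub_exp_sub_mul_nonneg (a b : ℝ) :
    0 ≤ Real.exp a - Real.exp b - (a - b) * Real.exp b := by
  have h : Real.exp a = Real.exp (a - b) * Real.exp b := by rw [← Real.exp_add]; simp
  nlinarith [Real.add_one_le_exp (a - b), Real.exp_pos b]

theorem eq_of_exp_sub_exp_sub_mul_eq_zero {a b : ℝ}
    (hab : Real.exp a - Real.exp b - (a - b) * Real.exp b = 0) : a = b := by
  by_contra hne
  have h : Real.exp a = Real.exp (a - b) * Real.exp b := by rw [← Real.exp_add]; simp
  nlinarith [Real.add_one_lt_exp (sub_ne_zero.2 hne), Real.exp_pos b]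

theorem trace_exp_sub_eq_sum {n : ℕ} {X Y : Matrix (Fin n) (Fin n) ℝ}
    (hX : X.IsHermitian) (hY : Y.IsHermitian) :
    (NormedSpace.exp X).trace - (NormedSpace.exp Y).trace
        - ((X - Y) * NormedSpace.exp Y).trace =
      ∑ i, ∑ j, (Real.exp (hX.eigenvalues i) - Real.exp (hY.eigenvalues j) -
          (hX.eigenvalues i - hY.eigenvalues j) * Real.exp (hY.eigenvalues j)) *
        ((star (hX.eigenvectorUnitary : Matrix (Fin n) (Fin n) ℝ) *
          (hY.eigenvectorUnitary : Matrix (Fin n) (Fin n) ℝ)) i j) ^ 2 := by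
  have hX' : IsSelfAdjoint X := hX
  have hY' : IsSelfAdjoint Y := hY
  have hc (f : ℝ → ℝ) : ContinuousOn f (spectrum ℝ Y) := Y.finite_real_spectrum.continuousOn f
  have e1 := trace_cfc_mul_cfc hX hY Real.exp (fun _ => 1)
  have e2 := trace_cfc_mul_cfc hX hY (fun _ => 1) Real.exp
  have e3 := trace_cfc_mul_cfc hX hY (fun x => x) Real.exp
  have e4 := trace_cfc_mul_cfc hX hY (fun _ => 1) (fun x => x * Real.exp x)
  rw [cfc_const_one ℝ Y, ← exp_eq_cfc_real_exp hX, mul_one] at e1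
  rw [cfc_const_one ℝ X, ← exp_eq_cfc_real_exp hY, one_mul] at e2
  rw [cfc_id' ℝ X, ← exp_eq_cfc_real_exp hY] at e3
  rw [cfc_const_one ℝ X, one_mul, cfc_mul _ _ Y (hc _) (hc _), cfc_id' ℝ Y,
    ← exp_eq_cfc_real_exp hY] at e4
  rw [sub_mul, Matrix.trace_sub, e1, e2, e3, e4]
  simp only [← Finset.sum_sub_distrib]
  refine Finset.sum_congr rfl fun i _ => Finset.sum_congr rfl fun j _ => ?_
  ring

/-- **Klein's inequality** for the exponential. -/
theorem klein_exp {n : ℕ} {X Y : Matrix (Fin n) (Fin n) ℝ}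
    (hX : X.IsHermitian) (hY : Y.IsHermitian) :
    0 ≤ (NormedSpace.exp X).trace - (NormedSpace.exp Y).trace
        - ((X - Y) * NormedSpace.exp Y).trace := by
  rw [trace_exp_sub_eq_sum hX hY]
  exact Finset.sum_nonneg fun i _ => Finset.sum_nonneg fun j _ =>
    mul_nonneg (exp_sub_exp_sub_mul_nonneg _ _) (sq_nonneg _)

/-- The equality case of Klein's inequality: each summand of `trace_exp_sub_eq_sum` vanishes, hence
so does each summand `(λᵢ - μⱼ)² Wᵢⱼ²` of `tr ((X - Y)²)`. -/
theorem eq_of_klein_exp_eq_zero {n : ℕ} {X Y : Matrix (Fin n) (Fin n) ℝ}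
    (hX : X.IsHermitian) (hY : Y.IsHermitian)
    (h : (NormedSpace.exp X).trace - (NormedSpace.exp Y).trace
        - ((X - Y) * NormedSpace.exp Y).trace = 0) : X = Y := by
  have hX' : IsSelfAdjoint X := hX
  have hY' : IsSelfAdjoint Y := hY
  rw [trace_exp_sub_eq_sum hX hY] at h
  have hterm (i j : Fin n) : hX.eigenvalues i = hY.eigenvalues j ∨
      (star (hX.eigenvectorUnitary : Matrix (Fin n) (Fin n) ℝ) *
          (hY.eigenvectorUnitary : Matrix (Fin n) (Fin n) ℝ)) i j = 0 := by
    have hnn (i j : Fin n) := mul_nonneg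
      (exp_sub_exp_sub_mul_nonneg (hX.eigenvalues i) (hY.eigenvalues j))
      (sq_nonneg ((star (hX.eigenvectorUnitary : Matrix (Fin n) (Fin n) ℝ) *
          (hY.eigenvectorUnitary : Matrix (Fin n) (Fin n) ℝ)) i j))
    rw [Finset.sum_eq_zero_iff_of_nonneg
      fun i _ => Finset.sum_nonneg fun j _ => hnn i j] at h
    have h1 := h i (Finset.mem_univ i)
    rw [Finset.sum_eq_zero_iff_of_nonneg fun j _ => hnn i j] at h1
    rcases mul_eq_zero.1 (h1 j (Finset.mem_univ j)) with h2 | h2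
    · exact Or.inl (eq_of_exp_sub_exp_sub_mul_eq_zero h2)
    · exact Or.inr (by simpa using h2)
  have e1 := trace_cfc_mul_cfc hX hY (fun x => x ^ 2) (fun _ => 1)
  have e2 := trace_cfc_mul_cfc hX hY (fun x => x) (fun x => x)
  have e3 := trace_cfc_mul_cfc hX hY (fun _ => 1) (fun x => x ^ 2)
  rw [cfc_const_one ℝ Y, mul_one, cfc_pow_id X] at e1
  rw [cfc_id' ℝ X, cfc_id' ℝ Y] at e2
  rw [cfc_const_one ℝ X, one_mul, cfc_pow_id Y] at e3
  have hsq : ((X - Y).conjTranspose * (X - Y)).trace = 0 := by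
    rw [(hX.sub hY).eq]
    have hexp : ((X - Y) * (X - Y)).trace
        = (X ^ 2).trace - (X * Y).trace - (X * Y).trace + (Y ^ 2).trace := by
      rw [sub_mul, mul_sub, mul_sub, pow_two, pow_two]
      simp only [Matrix.trace_sub]
      rw [Matrix.trace_mul_comm Y X]
      ring
    rw [hexp, e1, e2, e3]
    simp only [← Finset.sum_sub_distrib, ← Finset.sum_add_distrib]
    refine Finset.sum_eq_zero fun i _ => Finset.sum_eq_zero fun j _ => ?_
    rcases hterm i j with h2 | h2
    · rw [h2]; ring
    · rw [h2]; ring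
  exact sub_eq_zero.1 (Matrix.trace_conjTranspose_mul_self_eq_zero_iff.1 hsq)

/-! ### Replacing the diagonal -/

theorem isHermitian_replaceDiag {n : ℕ} {A : Matrix (Fin n) (Fin n) ℝ} (hA : A.IsSymm)
    (x : Fin n → ℝ) : (replaceDiag A x).IsHermitian := by
  refine Matrix.IsHermitian.ext fun i j => ?_
  by_cases h : i = j
  · subst h; simp
  · simp [replaceDiag, h, Ne.symm h, hA.apply i j]

theorem replaceDiag_sub_replaceDiag {n : ℕ} (A : Matrix (Fin n) (Fin n) ℝ) (x y : Fin n → ℝ) :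
    replaceDiag A x - replaceDiag A y = Matrix.diagonal (x - y) := by
  ext i j
  by_cases h : i = j
  · subst h; simp [replaceDiag]
  · simp [replaceDiag, h]

theorem continuous_replaceDiag {n : ℕ} (A : Matrix (Fin n) (Fin n) ℝ) :
    Continuous (replaceDiag A) := by
  refine continuous_matrix fun i j => ?_
  by_cases h : i = j
  · subst h; simpa [replaceDiag] using continuous_apply i
  · simpa [replaceDiag, h] using continuous_const

theorem trace_diagonal_mul {n : ℕ} (d : Fin n → ℝ) (M : Matrix (Fin n) (Fin n) ℝ) :
    (Matrix.diagonal d * M).trace = ∑ i, d i * M i i := by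
  simp [Matrix.trace]

theorem isCorrelationMatrix_exp {n : ℕ} {X : Matrix (Fin n) (Fin n) ℝ} (hX : X.IsHermitian)
    (hd : ∀ i, NormedSpace.exp X i i = 1) : IsCorrelationMatrix (NormedSpace.exp X) := by
  refine ⟨?_, hd⟩
  have hh : ((1 / 2 : ℝ) • X).IsHermitian := by
    rw [Matrix.IsHermitian, Matrix.conjTranspose_smul, hX.eq]; simp
  have h2 : NormedSpace.exp X = (NormedSpace.exp ((1 / 2 : ℝ) • X)).conjTranspose *
      NormedSpace.exp ((1 / 2 : ℝ) • X) := by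
    rw [hh.exp.eq, ← Matrix.exp_add_of_commute _ _ (Commute.refl _), ← add_smul]
    norm_num
  rw [h2]
  exact Matrix.posSemidef_conjTranspose_mul_self _

/-- Uniqueness of the diagonal. -/
theorem eq_of_diag_exp_eq_one {n : ℕ} {A : Matrix (Fin n) (Fin n) ℝ} (hA : A.IsSymm)
    {x y : Fin n → ℝ} (hx : ∀ i, NormedSpace.exp (replaceDiag A x) i i = 1)
    (hy : ∀ i, NormedSpace.exp (replaceDiag A y) i i = 1) : x = y := by
  have k1 := klein_exp (isHermitian_replaceDiag hA x) (isHermitian_replaceDiag hA y)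
  have k2 := klein_exp (isHermitian_replaceDiag hA y) (isHermitian_replaceDiag hA x)
  have h := eq_of_klein_exp_eq_zero (isHermitian_replaceDiag hA x) (isHermitian_replaceDiag hA y)
  rw [replaceDiag_sub_replaceDiag, trace_diagonal_mul] at k1 k2 h
  simp only [hx, hy, mul_one, Pi.sub_apply, Finset.sum_sub_distrib] at k1 k2 h
  have h0 := h (by linarith)
  funext i
  have := congrFun (congrFun h0 i) i
  simpa [replaceDiag] using this

/-- The strictly convex function `x ↦ tr e^{A[x]} - ∑ xᵢ`, whose gradient `diag e^{A[x]} - 1` vanishes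
exactly at the diagonals that make `e^{A[x]}` a correlation matrix. -/
noncomputable def traceExpSubSum {n : ℕ} (A : Matrix (Fin n) (Fin n) ℝ) (x : Fin n → ℝ) : ℝ :=
  (NormedSpace.exp (replaceDiag A x)).trace - ∑ i, x i

theorem continuous_traceExpSubSum {n : ℕ} (A : Matrix (Fin n) (Fin n) ℝ) :
    Continuous (traceExpSubSum A) := by
  have h := (continuous_matrix_exp n).comp (continuous_replaceDiag A)
  exact h.matrix_trace.sub (continuous_finsetSum _ fun i _ => continuous_apply i)

theorem subgradient_traceExpSubSum {n : ℕ} {A : Matrix (Fin n) (Fin n) ℝ} (hA : A.IsSymm)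
    (x y : Fin n → ℝ) :
    ∑ i, (x i - y i) * (NormedSpace.exp (replaceDiag A y) i i - 1) ≤
      traceExpSubSum A x - traceExpSubSum A y := by
  have k := klein_exp (isHermitian_replaceDiag hA x) (isHermitian_replaceDiag hA y)
  rw [replaceDiag_sub_replaceDiag, trace_diagonal_mul] at k
  simp only [traceExpSubSum, mul_sub, mul_one, Finset.sum_sub_distrib, Pi.sub_apply] at k ⊢
  linarith

theorem abs_le_exp_sub_self (t : ℝ) : |t| ≤ Real.exp t - t := by
  rw [abs_le']
  constructor
  · have h : Real.exp t = Real.exp (t / 2) * Real.exp (t / 2) := by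
      rw [← Real.exp_add]; ring_nf
    nlinarith [Real.add_one_le_exp (t / 2), Real.exp_pos (t / 2), sq_nonneg (t / 2 - 1),
      sq_nonneg (Real.exp (t / 2) - 2)]
  · linarith [Real.exp_pos t]

/-- Klein's inequality against the diagonal part `diag x` of `A[x]` bounds the trace of the
exponential below by `∑ e^{xᵢ}`. -/
theorem norm_le_traceExpSubSum {n : ℕ} {A : Matrix (Fin n) (Fin n) ℝ} (hA : A.IsSymm)
    (x : Fin n → ℝ) : ‖x‖ ≤ traceExpSubSum A x := by
  have k := klein_exp (isHermitian_replaceDiag hA x) (Matrix.isHermitian_diagonal x)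
  have hexp : (NormedSpace.exp x : Fin n → ℝ) = fun i => Real.exp (x i) := by
    funext i
    rw [Pi.coe_exp, Real.exp_eq_exp_ℝ]
  have h0 : ((replaceDiag A x - Matrix.diagonal x) *
      Matrix.diagonal fun i => Real.exp (x i)).trace = 0 := by
    simp [Matrix.trace, Matrix.mul_diagonal, replaceDiag]
  rw [Matrix.exp_diagonal, hexp, h0, Matrix.trace_diagonal] at k
  have hsum : ∑ i, |x i| ≤ ∑ i, (Real.exp (x i) - x i) :=
    Finset.sum_le_sum fun i _ => abs_le_exp_sub_self (x i)
  have hnorm : ‖x‖ ≤ ∑ i, |x i| := by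
    refine (pi_norm_le_iff_of_nonneg (Finset.sum_nonneg fun i _ => abs_nonneg _)).2 fun i => ?_
    exact Finset.single_le_sum (f := fun i => |x i|) (fun i _ => abs_nonneg _) (Finset.mem_univ i)
  rw [Finset.sum_sub_distrib] at hsum
  simp only [traceExpSubSum]
  linarith

theorem exists_diag_exp_eq_one {n : ℕ} {A : Matrix (Fin n) (Fin n) ℝ} (hA : A.IsSymm) :
    ∃ x : Fin n → ℝ, ∀ i, NormedSpace.exp (replaceDiag A x) i i = 1 := by
  obtain ⟨x, hx⟩ := (continuous_traceExpSubSum A).exists_forall_le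
    (Filter.tendsto_atTop_mono (norm_le_traceExpSubSum hA) (tendsto_norm_cocompact_atTop))
  refine ⟨x, ?_⟩
  set g : (Fin n → ℝ) → Fin n → ℝ :=
    fun y i => NormedSpace.exp (replaceDiag A y) i i - 1 with hg
  have hgc (i : Fin n) : Continuous fun y => g y i :=
    (((continuous_matrix_exp n).comp (continuous_replaceDiag A)).matrix_elem i i).sub
      continuous_const
  -- Minimality at `x` and the subgradient at `x - t g(x)` give `⟪g(x), g(x - t g(x))⟫ ≤ 0` for
  -- `t > 0`; letting `t` tend to `0` gives `‖g(x)‖² ≤ 0`.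
  have hle (t : ℝ) (ht : 0 < t) : ∑ i, g x i * g (x - t • g x) i ≤ 0 := by
    have h1 := subgradient_traceExpSubSum hA x (x - t • g x)
    have h2 := hx (x - t • g x)
    have h3 : ∑ i, (x i - (x - t • g x) i) *
        (NormedSpace.exp (replaceDiag A (x - t • g x)) i i - 1) =
        t * ∑ i, g x i * g (x - t • g x) i := by
      rw [Finset.mul_sum]
      refine Finset.sum_congr rfl fun i _ => ?_
      simp only [hg, Pi.sub_apply, Pi.smul_apply, smul_eq_mul]
      ring
    rw [h3] at h1
    by_contra hpos
    have := mul_pos ht (not_le.1 hpos)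
    linarith
  have hcont : Continuous fun t : ℝ => ∑ i, g x i * g (x - t • g x) i :=
    continuous_finsetSum _ fun i _ => continuous_const.mul
      ((hgc i).comp (continuous_const.sub (continuous_id.smul continuous_const)))
  have hlim : ∑ i, g x i * g x i ≤ 0 := by
    have ht : Filter.Tendsto (fun t : ℝ => ∑ i, g x i * g (x - t • g x) i)
        (nhdsWithin 0 (Set.Ioi 0)) (nhds (∑ i, g x i * g x i)) := by
      simpa using (hcont.tendsto 0).mono_left nhdsWithin_le_nhds
    exact le_of_tendsto ht (Filter.eventually_of_mem self_mem_nhdsWithin hle)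
  intro i
  have hz := (Finset.sum_eq_zero_iff_of_nonneg fun i _ => mul_self_nonneg (g x i)).1
    (le_antisymm hlim (Finset.sum_nonneg fun i _ => mul_self_nonneg (g x i))) i (Finset.mem_univ i)
  exact sub_eq_zero.1 (mul_self_eq_zero.1 hz)

/-! ### The matrix logarithm -/

theorem matrixLog_exp {n : ℕ} {X : Matrix (Fin n) (Fin n) ℝ} (hX : X.IsHermitian) :
    matrixLog (NormedSpace.exp X) = X := by
  have hX' : IsSelfAdjoint X := hX
  rw [matrixLog, exp_eq_cfc_real_exp hX, ← cfc_comp' Real.log Real.exp X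
    ((X.finite_real_spectrum.image _).continuousOn _) (X.finite_real_spectrum.continuousOn _)]
  simp only [Real.log_exp]
  exact cfc_id' ℝ X

theorem isHermitian_matrixLog {n : ℕ} (C : Matrix (Fin n) (Fin n) ℝ) :
    (matrixLog C).IsHermitian :=
  cfc_predicate Real.log C

theorem exp_matrixLog {n : ℕ} {C : Matrix (Fin n) (Fin n) ℝ} (hC : C.PosDef) :
    NormedSpace.exp (matrixLog C) = C := by
  have hC' : IsSelfAdjoint C := hC.isHermitian
  rw [exp_eq_cfc_real_exp (isHermitian_matrixLog C), matrixLog, ← cfc_comp' Real.exp Real.log C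
    ((C.finite_real_spectrum.image _).continuousOn _) (C.finite_real_spectrum.continuousOn _)]
  refine (cfc_congr fun t ht => ?_).trans (cfc_id' ℝ C)
  rw [hC.isHermitian.spectrum_real_eq_range_eigenvalues] at ht
  obtain ⟨i, rfl⟩ := ht
  exact Real.exp_log (hC.eigenvalues_pos i)

/-! ### The entries below the diagonal -/

theorem eq_of_vecl_eq {n : ℕ} {A B : Matrix (Fin n) (Fin n) ℝ} (h : vecl A = vecl B)
    {i j : Fin n} (hij : j < i) : A i j = B i j := by
  have hmem : toLex (j, i) ∈ belowDiag n := by simpa [belowDiag] using hij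
  rw [← Finset.mem_coe, ← Finset.range_orderEmbOfFin _ (card_belowDiag n)] at hmem
  obtain ⟨k, hk⟩ := hmem
  have := congrFun h k
  simpa only [vecl, hk, ofLex_toLex] using this

theorem vecl_congr {n : ℕ} {A B : Matrix (Fin n) (Fin n) ℝ}
    (h : ∀ i j, j < i → A i j = B i j) : vecl A = vecl B := by
  funext k
  have hk := Finset.orderEmbOfFin_mem _ (card_belowDiag n) k
  exact h _ _ (Finset.mem_filter.1 hk).2

theorem exists_isSymm_vecl_eq {n : ℕ} (v : Fin (n * (n - 1) / 2) → ℝ) :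
    ∃ A : Matrix (Fin n) (Fin n) ℝ, A.IsSymm ∧ vecl A = v := by
  set e := (belowDiag n).orderEmbOfFin (card_belowDiag n) with he
  set w : Fin n ×ₗ Fin n → ℝ := Function.extend e v 0 with hw
  refine ⟨Matrix.of fun i j => w (toLex (min i j, max i j)), ?_, ?_⟩
  · ext i j
    simp [min_comm, max_comm]
  · funext k
    have hk := Finset.orderEmbOfFin_mem _ (card_belowDiag n) k
    have hlt : (ofLex (e k)).1 < (ofLex (e k)).2 := (Finset.mem_filter.1 hk).2
    have : vecl (Matrix.of fun i j => w (toLex (min i j, max i j))) k = w (e k) := by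
      simp only [vecl, Matrix.of_apply, ← he]
      rw [min_eq_right hlt.le, max_eq_left hlt.le]
      rfl
    rw [this, hw, e.injective.extend_apply]

/-! ### The parametrization of correlation matrices -/

theorem theorem1 (n : ℕ) :
    (∀ A : Matrix (Fin n) (Fin n) ℝ, A.IsSymm →
      ∃! x : Fin n → ℝ, IsCorrelationMatrix (NormedSpace.exp (replaceDiag A x))) ∧
    Function.Bijective (corrGamma n) := by
  refine ⟨fun A hA => ?_, ?_, ?_⟩
  · obtain ⟨x, hx⟩ := exists_diag_exp_eq_one hA
    exact ⟨x, isCorrelationMatrix_exp (isHermitian_replaceDiag hA x) hx,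
      fun y hy => eq_of_diag_exp_eq_one hA hy.2 hx⟩
  · rintro ⟨C, ⟨hC, hC1⟩, hCu⟩ ⟨D, ⟨hD, hD1⟩, hDu⟩ h
    have eC := exp_matrixLog (hC.posDef_iff_isUnit.2 hCu)
    have eD := exp_matrixLog (hD.posDef_iff_isUnit.2 hDu)
    have sC := isHermitian_matrixLog C
    have sD := isHermitian_matrixLog D
    have hv : vecl (matrixLog C) = vecl (matrixLog D) := h
    have rC : replaceDiag (matrixLog C) (fun i => matrixLog C i i) = matrixLog C := by
      ext i j
      by_cases hij : i = j
      · subst hij; simp [replaceDiag]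
      · simp [replaceDiag, hij]
    -- `log C` and `log D` agree off the diagonal, so both are `(log C)[x]` for some `x`.
    have rD : replaceDiag (matrixLog C) (fun i => matrixLog D i i) = matrixLog D := by
      ext i j
      rcases lt_trichotomy i j with hij | hij | hij
      · simp only [replaceDiag, Matrix.of_apply, hij.ne, if_false]
        have h1 := sC.apply i j
        have h2 := sD.apply i j
        rw [star_trivial] at h1 h2
        rw [← h1, ← h2]
        exact eq_of_vecl_eq hv hij
      · subst hij; simp [replaceDiag]
      · simp only [replaceDiag, Matrix.of_apply, hij.ne', if_false]
        exact eq_of_vecl_eq hv hij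
    have hx : (fun i => matrixLog C i i) = fun i => matrixLog D i i := by
      refine eq_of_diag_exp_eq_one (A := matrixLog C) ?_ (fun i => ?_) fun i => ?_
      · rw [Matrix.IsSymm, ← Matrix.conjTranspose_eq_transpose_of_trivial]
        exact sC
      · rw [rC, eC, hC1]
      · rw [rD, eD, hD1]
    have hlog : matrixLog C = matrixLog D := by rw [← rC, hx, rD]
    exact Subtype.ext (eC.symm.trans ((congrArg NormedSpace.exp hlog).trans eD))
  · intro v
    obtain ⟨A, hA, rfl⟩ := exists_isSymm_vecl_eq v
    obtain ⟨x, hx⟩ := exists_diag_exp_eq_one hA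
    have hH := isHermitian_replaceDiag hA x
    refine ⟨⟨NormedSpace.exp (replaceDiag A x), isCorrelationMatrix_exp hH hx,
      Matrix.isUnit_exp _⟩, ?_⟩
    rw [corrGamma, matrixLog_exp hH]
    exact vecl_congr fun i j hij => by simp [replaceDiag, hij.ne']
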